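/- Let $X$ be a movable compact metric space, let $\mathbf p=(p_n)\colon X\to\{K_n,p_{n,n+1}\}_{n\in\mathbb N}$ be an HPol-expansion of $X$ indexed by the natural numbers, let $G$ be an abelian group and $k\ge 0$. Here HTop is the category of topological spaces and homotopy classes of continuous maps, and HPol is its full subcategory of spaces having the homotopy type of a polyhedron (the geometric realization, with the weak topology, of an abstract simplicial complex). An HPol-expansion of $X$ is a morphism $\mathbf p\colon X\to\mathbf K$ of pro-HTop to an inverse system $\mathbf K$ in HPol over a directed set such that for every inverse system $\mathbf Y$ in HPol every morphism $X\to\mathbf Y$ of pro-HTop equals $\mathbf f\circ\mathbf p$ for a unique morphism $\mathbf f\colon\mathbf K\to\mathbf Y$ of pro-HTop. An inverse system $(K_\lambda,p_{\lambda\lambda'},\Lambda)$ is movable if for every $\lambda$ there is $\lambda'\ge\lambda$ such that for every $\lambda''\ge\lambda$ there is a morphism $r\colon K_{\lambda'}\to K_{\lambda''}$ with $p_{\lambda\lambda'}=p_{\lambda\lambda''}\,r$. The space $X$ is movable if it has a movable HPol-expansion. Put $H_n=H_k(K_n;G)$ (singular homology), let $q_{n,m}\colon H_m\to H_n$ for $n\le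 m$ be the homomorphisms induced by the bonding morphisms, let $\check H_k(X)=\varprojlim_n H_n$ be the Čech homology group of $X$, and let $q_n\colon\check H_k(X)\to H_n$ be the projections. For $n<m$ put $H_{n,m}=\operatorname{im}(q_{n,m})$ and $E_{n,m}=H_n/H_{n,m}$. The inductive $n$-error $E_n^i$ is the inverse limit over $m>n$ of the groups $E_{n,m}$ under the natural homomorphisms $h+H_{n,m+1}\mapsto h+H_{n,m}$, and the real $n$-error is $E_n=H_n/q_n(\check H_k(X))$. Then $E_n=E_n^i$ for every $n$; precisely, the canonical homomorphism $$E_n\longrightarrow E_n^i,\qquad h+q_n(\check H_k(X))\longmapsto (h+H_{n,m})_{m>n},$$ is an isomorphism. -/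

import Mathlib

open CategoryTheory

universe u v

noncomputable section

/-! ### The homotopy category of spaces -/

/-- Two continuous maps are related when they are homotopic. -/
def homotopicRel : HomRel TopCat.{u} := fun _ _ f g => f.hom.Homotopic g.hom

instance homotopicRel_congruence : Congruence homotopicRel.{u} where
  equivalence := by
    intro X Y
    exact ⟨fun f => ContinuousMap.Homotopic.refl f.hom, fun h => ContinuousMap.Homotopic.symm h,
      fun h h' => ContinuousMap.Homotopic.trans h h'⟩
  comp_left := by
    intro X Y Z f g g' h
    exact ContinuousMap.Homotopic.comp h (ContinuousMap.Homotopic.refl f.hom)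
  comp_right := by
    intro X Y Z f f' g h
    exact ContinuousMap.Homotopic.comp (ContinuousMap.Homotopic.refl g.hom) h

/-- `HTop`: topological spaces and homotopy classes of continuous maps. -/
abbrev HTop := CategoryTheory.Quotient homotopicRel.{u}

/-- A topological space as an object of `HTop`. -/
abbrev HTop.of (X : Type u) [TopologicalSpace X] : HTop.{u} :=
  (CategoryTheory.Quotient.functor homotopicRel).obj (TopCat.of X)

/-! ### Polyhedra -/

/-- The points of the geometric realization `|K|` of an abstract simplicial complex `K`:
finitely supported families of barycentric coordinates whose support is a simplex of `K`. -/
def PreAbstractSimplicialComplex.Realization {V : Type u} (K : PreAbstractSimplicialComplex V) :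
    Type u :=
  {a : V →₀ ℝ // (∀ v, 0 ≤ a v) ∧ (a.sum fun _ t => t) = 1 ∧ a.support ∈ K.faces}

/-- The closed simplex `|σ|` of `|K|`. -/
def PreAbstractSimplicialComplex.closedSimplex {V : Type u} (K : PreAbstractSimplicialComplex V)
    (σ : Finset V) : Type u :=
  {a : K.Realization // a.1.support ⊆ σ}

/-- The Euclidean topology of a closed simplex: that of its barycentric coordinates. -/
instance PreAbstractSimplicialComplex.closedSimplexTopology {V : Type u}
    (K : PreAbstractSimplicialComplex V) (σ : Finset V) : TopologicalSpace (K.closedSimplex σ) :=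
  TopologicalSpace.induced (fun a => fun v : V => a.1.1 v) inferInstance

/-- The weak topology of `|K|`: a set is closed (open) iff it meets every closed simplex in a
closed (open) subset of that simplex. -/
instance PreAbstractSimplicialComplex.realizationTopology {V : Type u}
    (K : PreAbstractSimplicialComplex V) : TopologicalSpace K.Realization :=
  ⨆ σ ∈ K.faces,
    TopologicalSpace.coinduced (fun a : K.closedSimplex σ => a.1) inferInstance

/-- The objects of `HPol`, a full subcategory of `HTop`: the spaces that have the homotopy type
of a polyhedron. -/
def IsHPol (P : HTop.{u}) : Prop :=
  ∃ (V : Type u) (K : PreAbstractSimplicialComplex V), Nonempty (P ≅ HTop.of K.Realization)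

/-! ### Inverse systems, expansions and movability

An inverse system in `C` indexed by a directed set `Λ` is a functor `Λᵒᵖ ⥤ C`. -/

section Pro

variable {C : Type*} [Category C]

/-- The bonding morphism `X_l' ⟶ X_l`, for `l ≤ l'`, of an inverse system. -/
abbrev bondHom {Λ : Type*} [Preorder Λ] (X : Λᵒᵖ ⥤ C) {l l' : Λ} (h : l ≤ l') :
    X.obj (Opposite.op l') ⟶ X.obj (Opposite.op l) :=
  X.map (homOfLE h).op

/-- A morphism of inverse systems `X → Y`: an index function `M → Λ` and morphisms
`X_{index m} ⟶ Y_m` that are compatible with the bonding morphisms at some later index. -/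
structure SystemHom {Λ M : Type*} [Preorder Λ] [Preorder M] (X : Λᵒᵖ ⥤ C) (Y : Mᵒᵖ ⥤ C) where
  index : M → Λ
  hom : ∀ m : M, X.obj (Opposite.op (index m)) ⟶ Y.obj (Opposite.op m)
  compat : ∀ {m m' : M} (h : m ≤ m'), ∃ (l : Λ) (h₁ : index m ≤ l) (h₂ : index m' ≤ l),
    bondHom X h₁ ≫ hom m = bondHom X h₂ ≫ hom m' ≫ bondHom Y h

/-- The equivalence relation on morphisms of systems whose classes are the morphisms of pro-`C`. -/
def SystemHom.Equiv {Λ M : Type*} [Preorder Λ] [Preorder M] {X : Λᵒᵖ ⥤ C} {Y : Mᵒᵖ ⥤ C}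
    (f g : SystemHom X Y) : Prop :=
  ∀ m : M, ∃ (l : Λ) (h₁ : f.index m ≤ l) (h₂ : g.index m ≤ l),
    bondHom X h₁ ≫ f.hom m = bondHom X h₂ ≫ g.hom m

/-- `f ∘ p = h` in pro-`C`, where `p` and `h` are morphisms of pro-`C` out of a single object `T`.
Such a morphism `T → X` is a family of morphisms `T ⟶ X_l` that is compatible with the bonding
morphisms. -/
def SystemHom.Factors {Λ M : Type*} [Preorder Λ] [Preorder M] {X : Λᵒᵖ ⥤ C} {Y : Mᵒᵖ ⥤ C}
    (f : SystemHom X Y) {T : C} (p : (Functor.const Λᵒᵖ).obj T ⟶ X)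
    (h : (Functor.const Mᵒᵖ).obj T ⟶ Y) : Prop :=
  ∀ m : M, p.app (Opposite.op (f.index m)) ≫ f.hom m = h.app (Opposite.op m)

/-- Movable inverse systems. -/
def IsMovable {Λ : Type*} [Preorder Λ] (X : Λᵒᵖ ⥤ C) : Prop :=
  ∀ l : Λ, ∃ (l' : Λ) (h : l ≤ l'), ∀ (l'' : Λ) (h' : l ≤ l''),
    ∃ r : X.obj (Opposite.op l') ⟶ X.obj (Opposite.op l''), bondHom X h = r ≫ bondHom X h'

end Pro

/-- `p : X → K` is an `HPol`-expansion of `X`: `K` is an inverse system in `HPol`, and every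
morphism of pro-`HTop` from `X` to an inverse system in `HPol` factors through `p` by a unique
morphism of pro-`HTop`. -/
structure IsHPolExpansion {Λ : Type v} [Preorder Λ] [IsDirectedOrder Λ] [Nonempty Λ]
    {X : HTop.{u}} {K : Λᵒᵖ ⥤ HTop.{u}} (p : (Functor.const Λᵒᵖ).obj X ⟶ K) : Prop where
  isHPol : ∀ l : Λ, IsHPol (K.obj (Opposite.op l))
  exists_factor : ∀ (M : Type u) [Preorder M] [IsDirectedOrder M] [Nonempty M]
    (Y : Mᵒᵖ ⥤ HTop.{u}), (∀ m : M, IsHPol (Y.obj (Opposite.op m))) →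
    ∀ h : (Functor.const Mᵒᵖ).obj X ⟶ Y, ∃ f : SystemHom K Y, f.Factors p h
  factor_unique : ∀ (M : Type u) [Preorder M] [IsDirectedOrder M] [Nonempty M]
    (Y : Mᵒᵖ ⥤ HTop.{u}), (∀ m : M, IsHPol (Y.obj (Opposite.op m))) →
    ∀ (h : (Functor.const Mᵒᵖ).obj X ⟶ Y) (f g : SystemHom K Y),
      f.Factors p h → g.Factors p h → f.Equiv g

/-- A space is movable if it has a movable `HPol`-expansion. -/
def IsMovableSpace (X : Type u) [TopologicalSpace X] : Prop :=
  ∃ (Λ : Type u) (_ : Preorder Λ) (_ : IsDirectedOrder Λ) (_ : Nonempty Λ) (K : Λᵒᵖ ⥤ HTop.{u})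
    (p : (Functor.const Λᵒᵖ).obj (HTop.of X) ⟶ K), IsHPolExpansion p ∧ IsMovable K

/-! ### Homology -/

/-- The `k`-th singular homology `H_k(-; G)` as a functor on the homotopy category `HTop`. -/
def HTop.homology (G : Type u) [AddCommGroup G] (k : ℕ) : HTop.{u} ⥤ AddCommGrpCat.{u} :=
  CategoryTheory.Quotient.lift homotopicRel
    ((AlgebraicTopology.singularHomologyFunctor AddCommGrpCat.{u} k).obj (AddCommGrpCat.of G))
    (by
      rintro X Y f g ⟨H⟩
      exact TopCat.Homotopy.congr_homologyMap_singularChainComplexFunctor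
        (f := f) (g := g) H (AddCommGrpCat.of G) k)

/-! ### Inverse sequences of abelian groups and their errors -/

namespace InverseSequence

variable (H : ℕᵒᵖ ⥤ AddCommGrpCat.{u})

/-- The `n`-th term `H_n`. -/
abbrev term (n : ℕ) : Type u := H.obj (Opposite.op n)

/-- The homomorphism `q_{n,m} : H_m → H_n`, for `n ≤ m`. -/
def bond {n m : ℕ} (h : n ≤ m) : term H m →+ term H n := (bondHom H h).hom

theorem bond_comp {n m r : ℕ} (h : n ≤ m) (h' : m ≤ r) (x : term H r) :
    bond H h (bond H h' x) = bond H (h.trans h') x := by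
  have e : bondHom H (h.trans h') = bondHom H h' ≫ bondHom H h := by
    rw [← H.map_comp]; rfl
  simp only [bond, e]
  rfl

/-- The inverse limit of the sequence. For `H_n = H_k(K_n; G)`, with `{K_n}` an
`HPol`-expansion of `X`, this is the `k`-th Čech homology group of `X`. -/
def invLimit : AddSubgroup (∀ n, term H n) where
  carrier := {x | ∀ (n m : ℕ) (h : n ≤ m), bond H h (x m) = x n}
  zero_mem' := by intro n m h; simp
  add_mem' := by
    intro x y hx hy n m h
    rw [Pi.add_apply, Pi.add_apply, map_add, hx n m h, hy n m h]
  neg_mem' := by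
    intro x hx n m h
    rw [Pi.neg_apply, Pi.neg_apply, map_neg, hx n m h]

/-- The projection `q_n` of the inverse limit to `H_n`. -/
def proj (n : ℕ) : invLimit H →+ term H n :=
  (Pi.evalAddMonoidHom (fun n => term H n) n).comp (invLimit H).subtype

/-- The `(n,m)`-th group of inverse persistent homology `H_{n,m} = im q_{n,m}`. -/
def persistent {n m : ℕ} (h : n ≤ m) : AddSubgroup (term H n) := (bond H h).range

/-- The `(n,m)`-th inverse persistent error `E_{n,m} = H_n / H_{n,m}`. -/
abbrev persistentError {n m : ℕ} (h : n ≤ m) : Type u := term H n ⧸ persistent H h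

theorem persistent_anti {n m m' : ℕ} (h : n ≤ m) (h' : m ≤ m') :
    persistent H (h.trans h') ≤ persistent H h := by
  rintro _ ⟨x, rfl⟩
  exact ⟨bond H h' x, bond_comp H h h' x⟩

/-- The natural homomorphism `E_{n,m'} → E_{n,m}`, `x + H_{n,m'} ↦ x + H_{n,m}`, for `m ≤ m'`. -/
def errorMap {n m m' : ℕ} (h : n ≤ m) (h' : m ≤ m') :
    persistentError H (h.trans h') →+ persistentError H h :=
  QuotientAddGroup.map _ _ (AddMonoidHom.id _) (persistent_anti H h h')

/-- The inductive `n`-error `E_n^i`: the inverse limit of the groups `E_{n,m}` over `m > n`. -/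
def inductiveError (n : ℕ) :
    AddSubgroup (∀ m : Set.Ioi n, persistentError H (le_of_lt (Set.mem_Ioi.1 m.2))) where
  carrier := {x | ∀ (m m' : Set.Ioi n) (h : m.1 ≤ m'.1),
    errorMap H (le_of_lt (Set.mem_Ioi.1 m.2)) h (x m') = x m}
  zero_mem' := by intro m m' h; exact map_zero _
  add_mem' := by
    intro x y hx hy m m' h
    rw [Pi.add_apply, Pi.add_apply, map_add, hx m m' h, hy m m' h]
  neg_mem' := by
    intro x hx m m' h
    rw [Pi.neg_apply, Pi.neg_apply, map_neg, hx m m' h]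

/-- The `n`-th real error `E_n = H_n / q_n(lim H)`. -/
abbrev realError (n : ℕ) : Type u := term H n ⧸ (proj H n).range

theorem range_proj_le {n m : ℕ} (h : n ≤ m) : (proj H n).range ≤ persistent H h := by
  rintro _ ⟨x, rfl⟩
  exact ⟨x.1 m, x.2 n m h⟩

/-- The canonical homomorphism `E_n → E_n^i`, `x + q_n(lim H) ↦ (x + H_{n,m})_{m > n}`. -/
def realToInductive (n : ℕ) : realError H n →+ inductiveError H n :=
  QuotientAddGroup.lift (proj H n).range
    { toFun := fun x => ⟨fun _ => QuotientAddGroup.mk x, fun _ _ _ => rfl⟩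
      map_zero' := rfl
      map_add' := fun _ _ => rfl }
    (by
      intro x hx
      apply Subtype.ext
      funext m
      exact (QuotientAddGroup.eq_zero_iff x).2
        (range_proj_le H (le_of_lt (Set.mem_Ioi.1 m.2)) hx))

end InverseSequence

end

/-! ### Movability of expansions -/

section Pro

variable {C : Type*} [Category C]

/-! Two `HPol`-expansions of one space are isomorphic in pro-`HTop`, and movability passes to
dominated systems (`IsMovable.of_dominated`), so the given sequence is movable. Functors preserve
movability, and a movable sequence of groups is Mittag-Leffler: the images `H_{n,m}` become constant
in `m`. Their eventual value is both the intersection of all `H_{n,m}` and the image of the limit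
(`MittagLeffler.stableImage_le_range_proj`). Hence the groups `E_{n,m}` are eventually constant,
equal to `E_n`, and so is their limit. -/

theorem bondHom_comp {Λ : Type*} [Preorder Λ] (X : Λᵒᵖ ⥤ C) {a b c : Λ} (h : a ≤ b) (h' : b ≤ c) :
    bondHom X h' ≫ bondHom X h = bondHom X (h.trans h') :=
  (X.map_comp _ _).symm

theorem bondHom_comp_assoc {Λ : Type*} [Preorder Λ] (X : Λᵒᵖ ⥤ C) {a b c : Λ} (h : a ≤ b)
    (h' : b ≤ c) {Z : C} (f : X.obj (Opposite.op a) ⟶ Z) :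
    bondHom X h' ≫ bondHom X h ≫ f = bondHom X (h.trans h') ≫ f := by
  rw [← Category.assoc, bondHom_comp]

/-- The composite of two morphisms of inverse systems. -/
def SystemHom.comp {Λ M N : Type*} [Preorder Λ] [IsDirectedOrder Λ] [Preorder M] [Preorder N]
    {X : Λᵒᵖ ⥤ C} {Y : Mᵒᵖ ⥤ C} {Z : Nᵒᵖ ⥤ C} (f : SystemHom X Y) (g : SystemHom Y Z) :
    SystemHom X Z where
  index := fun n => f.index (g.index n)
  hom := fun n => f.hom (g.index n) ≫ g.hom n
  compat := by
    intro n n' h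
    obtain ⟨m, h₁, h₂, e⟩ := g.compat h
    obtain ⟨a, ha₁, ha₂, ea⟩ := f.compat h₁
    obtain ⟨b, hb₁, hb₂, eb⟩ := f.compat h₂
    obtain ⟨c, hac, hbc⟩ := exists_ge_ge a b
    refine ⟨c, ha₁.trans hac, hb₁.trans hbc, ?_⟩
    have ea' := congrArg (fun t => bondHom X hac ≫ t ≫ g.hom n) ea
    have eb' := congrArg (fun t => bondHom X hbc ≫ t ≫ g.hom n' ≫ bondHom Z h) eb
    simp only [Category.assoc, bondHom_comp_assoc, e] at ea' eb' ⊢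
    rw [ea', eb']

/-- The reindexing of an inverse system along a lift of the index set to a larger universe. -/
def uliftSystem {Λ : Type} [Preorder Λ] (X : Λᵒᵖ ⥤ C) : (ULift.{u} Λ)ᵒᵖ ⥤ C :=
  (Monotone.functor (f := (ULift.down : ULift.{u} Λ → Λ)) (fun _ _ h => h)).op ⋙ X

/-- The reindexing of a morphism from an object to an inverse system. -/
def uliftCone {Λ : Type} [Preorder Λ] {T : C} {X : Λᵒᵖ ⥤ C} (p : (Functor.const Λᵒᵖ).obj T ⟶ X) :
    (Functor.const (ULift.{u} Λ)ᵒᵖ).obj T ⟶ uliftSystem.{u} X where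
  app := fun l => p.app (Opposite.op l.unop.down)
  naturality := fun _ _ f => p.naturality
    ((Monotone.functor (f := (ULift.down : ULift.{u} Λ → Λ)) (fun _ _ h => h)).op.map f)

/-- The canonical isomorphism from an inverse system to its reindexing. -/
def toUliftSystem {Λ : Type} [Preorder Λ] (X : Λᵒᵖ ⥤ C) : SystemHom X (uliftSystem.{u} X) where
  index := ULift.down
  hom := fun l => 𝟙 (X.obj (Opposite.op l.down))
  compat := by
    intro l l' h
    refine ⟨l'.down, h, le_rfl, ?_⟩
    change bondHom X _ ≫ 𝟙 _ = bondHom X _ ≫ 𝟙 _ ≫ bondHom X _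
    rw [Category.comp_id, Category.id_comp, bondHom_comp]

theorem cone_bondHom {Λ : Type*} [Preorder Λ] {T : C} {X : Λᵒᵖ ⥤ C}
    (p : (Functor.const Λᵒᵖ).obj T ⟶ X) {l l' : Λ} (h : l ≤ l') :
    p.app (Opposite.op l') ≫ bondHom X h = p.app (Opposite.op l) := by
  have := p.naturality (homOfLE h).op
  simpa using this.symm

/-- An inverse system that is dominated by a movable one in the pro-category is movable. -/
theorem IsMovable.of_dominated {Λ : Type} {M : Type*} [Preorder Λ] [IsDirectedOrder Λ] [Preorder M]
    {X : Λᵒᵖ ⥤ C} {Y : Mᵒᵖ ⥤ C} (hY : IsMovable Y) (f : SystemHom X Y)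
    (g : SystemHom Y (uliftSystem.{u} X))
    (hfg : (f.comp g).Equiv (toUliftSystem X)) : IsMovable X := by
  intro n
  obtain ⟨l', hl, hmov⟩ := hY (g.index ⟨n⟩)
  obtain ⟨a, ha₁, ha₂, ea⟩ := f.compat hl
  obtain ⟨b, hb₁, hb₂, eb⟩ := hfg ⟨n⟩
  obtain ⟨m, ham, hbm⟩ := exists_ge_ge a b
  change f.index (g.index ⟨n⟩) ≤ b at hb₁
  change n ≤ b at hb₂
  -- The index `m` depends on `n` alone: past `a`, `f` respects the bond `Y_{l'} → Y_{g.index n}`;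
  -- past `b`, `g ∘ f` agrees with the identity at `n`.
  refine ⟨m, hb₂.trans hbm, fun r hr => ?_⟩
  obtain ⟨l'', h₁, h₂, e⟩ := g.compat (m := ⟨n⟩) (m' := ⟨r⟩) hr
  obtain ⟨s, hs⟩ := hmov l'' h₁
  obtain ⟨gn, hgn⟩ : ∃ t : Y.obj (Opposite.op (g.index ⟨n⟩)) ⟶ X.obj (Opposite.op n),
    t = g.hom ⟨n⟩ := ⟨_, rfl⟩
  obtain ⟨gr, hgr⟩ : ∃ t : Y.obj (Opposite.op (g.index ⟨r⟩)) ⟶ X.obj (Opposite.op r),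
    t = g.hom ⟨r⟩ := ⟨_, rfl⟩
  have eb' : bondHom X hb₁ ≫ f.hom (g.index ⟨n⟩) ≫ gn = bondHom X hb₂ := by
    rw [hgn]
    exact eb.trans (Category.comp_id _)
  have e' : bondHom Y h₁ ≫ gn = bondHom Y h₂ ≫ gr ≫ bondHom X hr := by
    rw [hgn, hgr]
    exact e
  have key := congrArg (fun t => bondHom X ham ≫ t ≫ gn) ea
  simp only [Category.assoc, bondHom_comp_assoc] at key
  -- Cross to `Y` by `f`, climb from `l'` to `l''` by movability of `Y`, and return to `X_r` by `g`.
  refine ⟨bondHom X (ha₂.trans ham) ≫ f.hom l' ≫ s ≫ bondHom Y h₂ ≫ gr, ?_⟩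
  simp only [Category.assoc]
  rw [← bondHom_comp X hb₂ hbm, ← eb', bondHom_comp_assoc, key, hs, Category.assoc, e']

end Pro

/-- Every `HPol`-expansion of a movable space is movable. -/
theorem IsHPolExpansion.isMovable {Λ : Type} [Preorder Λ] [IsDirectedOrder Λ] [Nonempty Λ]
    {X : Type u} [TopologicalSpace X] (hX : IsMovableSpace X) {K : Λᵒᵖ ⥤ HTop.{u}}
    {p : (Functor.const Λᵒᵖ).obj (HTop.of X) ⟶ K} (hp : IsHPolExpansion p) : IsMovable K := by
  obtain ⟨M, _, _, _, L, q, hq, hL⟩ := hX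
  -- The universal property only tests systems indexed in `Type u`, so `K` enters as a target
  -- through its lifted reindexing.
  have : IsDirectedOrder (ULift.{u} Λ) := ⟨fun a b => by
    obtain ⟨c, hac, hbc⟩ := exists_ge_ge a.down b.down
    exact ⟨⟨c⟩, hac, hbc⟩⟩
  obtain ⟨f, hf⟩ := hp.exists_factor M L hq.isHPol q
  obtain ⟨g, hg⟩ := hq.exists_factor (ULift.{u} Λ) (uliftSystem K) (fun m => hp.isHPol m.down)
    (uliftCone p)
  refine hL.of_dominated f g (hp.factor_unique (ULift.{u} Λ) (uliftSystem K)
    (fun m => hp.isHPol m.down) (uliftCone p) _ _ (fun m => ?_) (fun m => Category.comp_id _))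
  change p.app _ ≫ f.hom _ ≫ g.hom m = _
  rw [← Category.assoc, hf (g.index m), hg m]

/-- The image of a movable inverse system under a functor is movable. -/
theorem IsMovable.comp_functor {C D : Type*} [Category C] [Category D] {Λ : Type*} [Preorder Λ]
    {X : Λᵒᵖ ⥤ C} (hX : IsMovable X) (F : C ⥤ D) : IsMovable (X ⋙ F) := by
  intro l
  obtain ⟨l', h, H⟩ := hX l
  refine ⟨l', h, fun l'' h' => ?_⟩
  obtain ⟨r, hr⟩ := H l'' h'
  exact ⟨F.map r, (congrArg F.map hr).trans (F.map_comp _ _)⟩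

/-! ### The Mittag-Leffler property -/

namespace InverseSequence

variable (H : ℕᵒᵖ ⥤ AddCommGrpCat.{u})

/-- The Mittag-Leffler property: the images of the bonding homomorphisms stabilize. -/
def MittagLeffler : Prop :=
  ∀ n : ℕ, ∃ (m : ℕ) (h : n ≤ m), ∀ (r : ℕ) (h' : n ≤ r), persistent H h ≤ persistent H h'

variable {H}

/-- Factoring `q_{n,m}` through `q_{n,r}` puts its image inside that of `q_{n,r}`. -/
theorem mittagLeffler_of_isMovable (hH : IsMovable H) : MittagLeffler H := by
  intro n
  obtain ⟨m, h, hm⟩ := hH n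
  refine ⟨m, h, fun r h' => ?_⟩
  obtain ⟨s, hs⟩ := hm r h'
  rintro _ ⟨x, rfl⟩
  refine ⟨s.hom x, ?_⟩
  simp only [bond, hs]
  rfl

variable (H) in
/-- The stable image in `H_n`: the intersection of all images `H_{n,m}`. -/
def stableImage (n : ℕ) : AddSubgroup (term H n) :=
  ⨅ (m : ℕ) (h : n ≤ m), persistent H h

theorem mem_stableImage {n : ℕ} {x : term H n} :
    x ∈ stableImage H n ↔ ∀ (m : ℕ) (h : n ≤ m), x ∈ persistent H h := by
  simp only [stableImage, AddSubgroup.mem_iInf]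

/-- Lift `x` to a stage `m` where the images in `H_{n+1}` have stabilized, then push down to
`H_{n+1}`. -/
theorem MittagLeffler.exists_lift (hH : MittagLeffler H) {n : ℕ} {x : term H n}
    (hx : x ∈ stableImage H n) :
    ∃ y ∈ stableImage H (n + 1), bond H n.le_succ y = x := by
  obtain ⟨m, h, hm⟩ := hH (n + 1)
  obtain ⟨z, rfl⟩ := mem_stableImage.1 hx m (n.le_succ.trans h)
  exact ⟨bond H h z, mem_stableImage.2 fun r h' => hm r h' ⟨z, rfl⟩, bond_comp H _ _ z⟩

theorem bond_self {n : ℕ} (x : term H n) : bond H le_rfl x = x := by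
  have e : bondHom H (le_refl n) = 𝟙 _ := H.map_id _
  simp only [bond, e]
  rfl

theorem MittagLeffler.stableImage_le_range_proj (hH : MittagLeffler H) (n : ℕ) :
    stableImage H n ≤ (proj H n).range := by
  intro x hx
  choose lift lift_mem bond_lift using
    fun (m : ℕ) (y : stableImage H m) => hH.exists_lift y.2
  -- Iterated lifting gives a coherent thread above `x`, starting in degree `n`.
  let y : ∀ i : ℕ, stableImage H (n + i) := fun i =>
    Nat.rec (motive := fun i => stableImage H (n + i)) ⟨x, hx⟩
      (fun i z => ⟨lift (n + i) z, lift_mem (n + i) z⟩) i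
  have step : ∀ i, bond H (Nat.le_succ (n + i)) (y (i + 1)).1 = (y i).1 :=
    fun i => bond_lift (n + i) (y i)
  have hy : ∀ (i j : ℕ) (h : i ≤ j), bond H (Nat.add_le_add_left h n) (y j).1 = (y i).1 := by
    intro i j h
    induction j, h using Nat.le_induction with
    | base => exact bond_self _
    | succ j h ih => rw [← ih, ← step j, bond_comp]
  -- Projecting from `H_{n+j}` to `H_j` also covers `j < n` and avoids subtracting indices.
  refine ⟨⟨fun j => bond H (Nat.le_add_left j n) (y j).1, fun i j h => ?_⟩, ?_⟩
  · change _ = bond H (Nat.le_add_left i n) (y i).1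
    rw [bond_comp, ← hy i j h, bond_comp]
  · exact hy 0 n (Nat.zero_le n)

theorem MittagLeffler.bijective_realToInductive (hH : MittagLeffler H) (n : ℕ) :
    Function.Bijective (realToInductive H n) := by
  constructor
  · rw [injective_iff_map_eq_zero]
    intro a ha
    obtain ⟨x, rfl⟩ := QuotientAddGroup.mk_surjective a
    refine (QuotientAddGroup.eq_zero_iff x).2
      (hH.stableImage_le_range_proj n (mem_stableImage.2 fun m h => ?_))
    have hx : x ∈ persistent H (h.trans m.le_succ) :=
      (QuotientAddGroup.eq_zero_iff x).1
        -- The limit runs over indices strictly above `n`, while `m = n` is allowed here; hence `m +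
        -- 1`.
        (congrFun (congrArg Subtype.val ha) ⟨m + 1, Nat.lt_succ_of_le h⟩)
    exact persistent_anti H h m.le_succ hx
  · intro e
    obtain ⟨m, h, hm⟩ := hH n
    let s : Set.Ioi n := ⟨m + 1, Nat.lt_succ_of_le h⟩
    obtain ⟨x, hx⟩ := QuotientAddGroup.mk_surjective (e.1 s)
    refine ⟨QuotientAddGroup.mk x, Subtype.ext (funext fun r => ?_)⟩
    change QuotientAddGroup.mk x = e.1 r
    rcases le_total r.1 s.1 with hr | hr
    · rw [← e.2 r s hr, ← hx]
      rfl
    -- Beyond `s` the images are constant, so congruence modulo `H_{n,s}` already gives congruence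
    -- modulo `H_{n,r}`.
    · obtain ⟨z, hz⟩ := QuotientAddGroup.mk_surjective (e.1 r)
      have hs := e.2 s r hr
      rw [← hx, ← hz] at hs
      rw [← hz, QuotientAddGroup.eq]
      have hzx : -z + x ∈ persistent H (le_of_lt (Set.mem_Ioi.1 s.2)) :=
        QuotientAddGroup.eq.1 hs
      have hxz := neg_mem (hm r.1 (le_of_lt (Set.mem_Ioi.1 r.2))
        (persistent_anti H h m.le_succ hzx))
      simpa [add_comm] using hxz

end InverseSequence

/-- For an `HPol`-expansion `{K_n}` of a movable compact metric space, the canonical homomorphism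
from the real `n`-error of the homology sequence `{H_k(K_n; G)}` to its inductive `n`-error is an
isomorphism. -/
theorem mainTheorem3 (X : Type u) [MetricSpace X] [CompactSpace X] (hX : IsMovableSpace X)
    (K : ℕᵒᵖ ⥤ HTop.{u}) (p : (Functor.const ℕᵒᵖ).obj (HTop.of X) ⟶ K)
    (hp : IsHPolExpansion p) (G : Type u) [AddCommGroup G] (k n : ℕ) :
    Function.Bijective (InverseSequence.realToInductive (K ⋙ HTop.homology G k) n) :=
  (InverseSequence.mittagLeffler_of_isMovable
    ((hp.isMovable hX).comp_functor _)).bijective_realToInductive n
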